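/- Let $X$ be a separable real Hilbert space and let $P(X)$ be the set of Radon probability measures on $X$. For $\mu\in P(X)$ write $\widehat\mu(\varrho)=\int_X e^{i\varrho(u)}\,d\mu(u)$, $\varrho\in X^*$. A measure $\mu\in P(X)$ is called self-decomposable if for every $\beta\in(0,1)$ there is $\mu_\beta\in P(X)$ (an innovation of $\mu$) with $\widehat\mu(\varrho)=\widehat\mu(\beta\varrho)\,\widehat{\mu_\beta}(\varrho)$ for all $\varrho\in X^*$. For $p,\sigma>0$ let $BK(p,\sigma)$ be the Bessel-K distribution on $\mathbb R$, with Lebesgue density $$t\mapsto \frac{1}{\sqrt{\pi}\,\Gamma(p)\,\sigma^{p+1/2}\,2^{p-1/2}}\,|t|^{p-1/2}K_{p-1/2}\big(|t/\sigma|\big),$$ where $K_\nu$ is the modified Bessel function of the second kind. For $\beta\in(0,1)$ let $\mathrm{Gamm}_\beta(p,\sigma)$ be the law of the compound Poisson sum $\sum_{k=1}^{\tau}\beta^{U_k}\theta_k$, where $\tau\sim\mathrm{Pois}(p\log(1/\beta))$, $U_k\sim U(0,1)$ and $\theta_k\sim\mathrm{Exp}(\sigma)$ (scale $\sigma$) are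 all independent, and let $BK_\beta(p,\sigma)$ be the law of $\xi_\beta-\xi_\beta'$ with $\xi_\beta,\xi'_\beta$ independent and $\mathrm{Gamm}_\beta(p,\sigma)$-distributed. Let $\mathcal R:X\to X$ be a Hilbert–Schmidt operator with an orthonormal basis $\{r_k\}$ of $X$ consisting of eigenvectors, $\mathcal R r_k=\gamma_k r_k$. For $p>0$ let $BK(p,\mathcal R)$ be the law of $u=\sum_k\gamma_k\eta_k r_k$ with $\{\eta_k\}$ i.i.d. $BK(p,1)$; for $\beta\in(0,1)$ let $BK(p,\beta\mathcal R)$ be defined in the same way from the eigenvalues $\beta\gamma_k$ and the same eigenvectors $r_k$ of $\beta\mathcal R$. Theorem. For every $p>0$ the series $u$ converges almost surely in $X$, and $BK(p,\mathcal R)$ belongs to $P(X)$ and is self-decomposable. For every $\beta\in(0,1)$ there is a measure $BK_\beta(p,\mathcal R)\in P(X)$ which is an innovation of $BK(p,\mathcal R)$, that is, $\widehat{BK}(p,\mathcal R;\varrho)=\widehat{BK}(p,\mathcal R;\beta\varrho)\,\widehat{BK}_\beta(p,\mathcal R;\varrho)$ for all $\varrho\in X^*$, and which satisfies $$\widehat{BK}(p,\mathcal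 R;\varrho)=\widehat{BK}(p,\beta\mathcal R;\varrho)\,\widehat{BK}_\beta(p,\mathcal R;\varrho)\qquad\text{for all }\varrho\in X^*.$$ It is the law of $v=\sum_k\gamma_k\eta_{\beta,k}r_k$, a series that converges almost surely in $X$, for every i.i.d. sequence $\{\eta_{\beta,k}\}$ with distribution $BK_\beta(p,1)$. -/

import Mathlib

open MeasureTheory ProbabilityTheory

noncomputable section

namespace BesselKPrior

/-! ### Distributions on the real line -/

/-- The modified Bessel function of the second kind
`K_ν(x) = ∫_0^∞ exp(-x cosh t) cosh(ν t) dt`, for real `ν` and `x > 0`. -/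
def modifiedBesselK (ν x : ℝ) : ℝ :=
  ∫ t in Set.Ioi (0 : ℝ), Real.exp (-x * Real.cosh t) * Real.cosh (ν * t)

/-- The Lebesgue density of the Bessel-K distribution with shape `p` and scale `σ`. -/
def besselKPDF (p σ t : ℝ) : ℝ :=
  1 / (Real.sqrt Real.pi * Real.Gamma p * σ ^ (p + 1 / 2) * (2 : ℝ) ^ (p - 1 / 2))
    * |t| ^ (p - 1 / 2) * modifiedBesselK (p - 1 / 2) |t / σ|

/-- The Bessel-K distribution `BK(p, σ)` on `ℝ`. -/
def besselK (p σ : ℝ) : Measure ℝ :=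
  volume.withDensity fun t => ENNReal.ofReal (besselKPDF p σ t)

/-- The compound Poisson gamma innovation `Gamm_β(p, σ)`: the law of
`∑_{k=1}^τ β ^ (U_k) * θ_k` where `τ` is Poisson with rate `p log (1/β)`, the `U_k` are uniform
on `[0,1]`, the `θ_k` are exponential with scale `σ` (that is, rate `1/σ`), and all these random
variables are independent. -/
def gammaInnovation (β p σ : ℝ) : Measure ℝ :=
  ((poissonMeasure (p * Real.log (1 / β)).toNNReal).prod
    ((Measure.infinitePi fun _ : ℕ => (volume : Measure ℝ).restrict (Set.Icc 0 1)).prod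
      (Measure.infinitePi fun _ : ℕ => expMeasure (1 / σ)))).map
    fun ω : ℕ × (ℕ → ℝ) × (ℕ → ℝ) => ∑ k ∈ Finset.range ω.1, β ^ (ω.2.1 k) * ω.2.2 k

/-- The Bessel-K innovation `BK_β(p, σ)` on `ℝ`: the law of the difference of two independent
`Gamm_β(p, σ)` random variables. -/
def besselKInnovation (β p σ : ℝ) : Measure ℝ :=
  ((gammaInnovation β p σ).prod (gammaInnovation β p σ)).map fun x : ℝ × ℝ => x.1 - x.2

/-! ### Measures on a Hilbert space -/

section Hilbert

variable {X : Type*} [NormedAddCommGroup X] [InnerProductSpace ℝ X]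

/-- Hilbert–Schmidt operators: `∑ ‖R e_i‖²` converges for some (equivalently, every)
orthonormal basis `(e_i)`. -/
def IsHilbertSchmidt (R : X →L[ℝ] X) : Prop :=
  ∃ (s : Set X) (e : HilbertBasis s ℝ X), Summable fun i : s => ‖R (e i)‖ ^ 2

/-- An orthonormal basis of `X` consisting of eigenvectors of `R`, with the eigenvalues. -/
structure EigenSystem (ι : Type*) (R : X →L[ℝ] X) where
  /-- the eigenvalues `γ_k` -/
  eigenvalue : ι → ℝ
  /-- the eigenvectors `r_k` -/
  eigenvector : HilbertBasis ι ℝ X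
  apply_eigenvector : ∀ k, R (eigenvector k) = eigenvalue k • eigenvector k

/-- The eigensystem `(β γ_k, r_k)` of `β R`. -/
def EigenSystem.smul {ι : Type*} {R : X →L[ℝ] X} (β : ℝ) (E : EigenSystem ι R) :
    EigenSystem ι (β • R) where
  eigenvalue k := β * E.eigenvalue k
  eigenvector := E.eigenvector
  apply_eigenvector k := by
    rw [_root_.smul_apply, E.apply_eigenvector, mul_smul]

/-- The random series `∑_k γ_k ξ_k r_k`, as a function of the coefficients `(ξ_k)`. -/
def EigenSystem.series {ι : Type*} {R : X →L[ℝ] X} (E : EigenSystem ι R) (ξ : ι → ℝ) : X :=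
  ∑' k, (E.eigenvalue k * ξ k) • E.eigenvector k

variable [MeasurableSpace X]

/-- The prior `BK(p, R)`: the law of `∑_k γ_k η_k r_k` with `η_k` i.i.d. `BK(p, 1)`. -/
def besselKPrior {ι : Type*} {R : X →L[ℝ] X} (p : ℝ) (E : EigenSystem ι R) : Measure X :=
  (Measure.infinitePi fun _ : ι => besselK p 1).map E.series

/-- The innovation `BK_β(p, R)`: the law of `∑_k γ_k η_{β,k} r_k` with `η_{β,k}` i.i.d.
`BK_β(p, 1)`. -/
def besselKPriorInnovation {ι : Type*} {R : X →L[ℝ] X} (β p : ℝ) (E : EigenSystem ι R) :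
    Measure X :=
  (Measure.infinitePi fun _ : ι => besselKInnovation β p 1).map E.series

/-- Membership in the space `P(X)` of Radon probability measures. -/
structure IsRadonProbability (μ : Measure X) : Prop where
  isProbabilityMeasure : IsProbabilityMeasure μ
  isLocallyFiniteMeasure : IsLocallyFiniteMeasure μ
  innerRegular : μ.InnerRegular
  outerRegular : μ.OuterRegular

/-- `ν` is an innovation of `μ` at level `β`: `μ̂(ϱ) = μ̂(β ϱ) ν̂(ϱ)` for all `ϱ ∈ X*`. -/
def IsInnovation (β : ℝ) (μ ν : Measure X) : Prop :=
  ∀ ϱ : StrongDual ℝ X, charFunDual μ ϱ = charFunDual μ (β • ϱ) * charFunDual ν ϱ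

/-- Self-decomposable Radon probability measures. -/
def IsSelfDecomposable (μ : Measure X) : Prop :=
  IsRadonProbability μ ∧
    ∀ β ∈ Set.Ioo (0 : ℝ) 1, ∃ ν : Measure X, IsRadonProbability ν ∧ IsInnovation β μ ν

end Hilbert

end BesselKPrior

end

/-! Everything reduces to an identity between characteristic functions on the line plus square
integrability. `besselK p 1` is the mixture of centred Gaussians of variance 2w with w gamma
distributed (`besselK_eq_bind`), so its characteristic function is E exp(-t²w) = (1 + t²)^(-p), and
its second moment is 2 E w < ∞.

`besselKInnovation β p 1` is a symmetrised compound Poisson law. The jumps β^U θ are such that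
integrating over U gives exactly log(1 + β²t²) - log(1 + t²) in the exponent, so its characteristic
function is ((1 + β²t²)/(1 + t²))^p, the quotient of that of BK at t and at βt.

In the Hilbert space, the eigenvalues are square summable, so coefficients with finite second moment
give an almost surely convergent series. Its characteristic functional is the limit of finite
products of scalar ones (`EigenSystem.tendsto_prod_charFun`), and the scalar identity passes through
each factor to the limit. -/

noncomputable section

namespace BesselKPrior

open scoped ENNReal NNReal Topology
open Filter

/-! ### Bessel-K as a gamma mixture of Gaussians -/

/-- The mixing kernel of the Bessel-K distribution: centred Gaussians of variance `2 w`. -/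
def gaussianMixKernel : Kernel ℝ ℝ where
  toFun w := gaussianReal 0 (2 * w).toNNReal
  measurable' := by
    exact measurable_gaussianReal.comp (by fun_prop : Measurable fun w : ℝ =>
      ((0 : ℝ), (2 * w).toNNReal))

instance : IsMarkovKernel gaussianMixKernel :=
  ⟨fun w => by change IsProbabilityMeasure (gaussianReal _ _); infer_instance⟩

lemma gaussianMixKernel_apply (w : ℝ) :
    gaussianMixKernel w = gaussianReal 0 (2 * w).toNNReal := rfl

lemma lintegral_gammaMeasure (p : ℝ) {f : ℝ → ℝ≥0∞} (hf : Measurable f) :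
    ∫⁻ w, f w ∂(gammaMeasure p 1) =
      ∫⁻ w in Set.Ioi 0, ENNReal.ofReal (1 / Real.Gamma p * w ^ (p - 1) * Real.exp (-w)) * f w := by
  have hm : Measurable (gammaPDF p 1) := (measurable_gammaPDFReal p 1).ennreal_ofReal
  rw [gammaMeasure, lintegral_withDensity_eq_lintegral_mul _ hm hf,
    ← lintegral_add_compl _ (measurableSet_Ioi (a := (0:ℝ))), Set.compl_Ioi,
    setLIntegral_congr (Iio_ae_eq_Iic (a := (0:ℝ))).symm,
    setLIntegral_congr_fun (g := fun _ => 0) measurableSet_Iio, lintegral_zero, add_zero]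
  · refine setLIntegral_congr_fun measurableSet_Ioi fun w hw => ?_
    simp [gammaPDF_of_nonneg (le_of_lt hw)]
  · intro w hw
    simp [gammaPDF_of_neg hw]

lemma lintegral_Ioi_comp_mul_exp {c : ℝ} (hc : 0 < c) (f : ℝ → ℝ≥0∞) :
    ∫⁻ w in Set.Ioi 0, f w =
      ∫⁻ t, ENNReal.ofReal (c * Real.exp t) * f (c * Real.exp t) := by
  have himg : (fun t => c * Real.exp t) '' Set.univ = Set.Ioi 0 := by
    ext w
    simp only [Set.image_univ, Set.mem_range, Set.mem_Ioi]
    refine ⟨fun ⟨t, ht⟩ => ht ▸ by positivity, fun hw => ⟨Real.log (w / c), ?_⟩⟩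
    rw [Real.exp_log (by positivity)]
    field_simp
  rw [← himg, lintegral_image_eq_lintegral_abs_deriv_mul MeasurableSet.univ
    (f' := fun t => c * Real.exp t)
    (fun t _ => ((Real.hasDerivAt_exp t).const_mul c).hasDerivWithinAt)]
  · rw [setLIntegral_univ]
    refine lintegral_congr fun t => ?_
    rw [abs_of_pos (by positivity)]
  · intro a _ b _ h
    exact Real.exp_injective (mul_left_cancel₀ hc.ne' h)

lemma lintegral_eq_lintegral_Ioi_add_neg (f : ℝ → ℝ≥0∞) (hf : Measurable f) :
    ∫⁻ t, f t = ∫⁻ t in Set.Ioi 0, (f t + f (-t)) := by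
  rw [lintegral_add_left hf, ← lintegral_add_compl f (measurableSet_Ioi (a := (0:ℝ))),
    Set.compl_Ioi]
  congr 1
  have := (Measure.measurePreserving_neg (volume : Measure ℝ)).setLIntegral_comp_emb
    (MeasurableEquiv.neg ℝ).measurableEmbedding f (Set.Ioi 0)
  simp only [Set.image_neg_eq_neg, Set.neg_Ioi, neg_zero] at this
  rw [← this.symm]
  exact setLIntegral_congr (Iio_ae_eq_Iic (a := (0:ℝ))).symm

/-- With w = |x| eᵗ / 2, the gamma and Gaussian exponents combine symmetrically: w + x²/(4w) = |x|
cosh t. The powers of w, Jacobian included, combine to w^(p - 1/2), whence the factor exp((p - 1/2)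
t). Folding t with -t later turns it into the cosh of the Bessel integral. -/
lemma gaussianMix_integrand {p x t : ℝ} (hx : x ≠ 0) :
    |x| / 2 * Real.exp t *
      ((1 / Real.Gamma p * (|x| / 2 * Real.exp t) ^ (p - 1) *
          Real.exp (-(|x| / 2 * Real.exp t))) *
        gaussianPDFReal 0 (2 * (|x| / 2 * Real.exp t)).toNNReal x) =
      1 / (Real.sqrt Real.pi * Real.Gamma p * 2 ^ (p - 1 / 2)) * |x| ^ (p - 1 / 2) *
        (2⁻¹ * Real.exp (-|x| * Real.cosh t + (p - 1 / 2) * t)) := by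
  have hx' : 0 < |x| := abs_pos.2 hx
  set w := |x| / 2 * Real.exp t with hw
  have hw0 : 0 < w := by positivity
  rw [gaussianPDFReal, Real.coe_toNNReal _ (by positivity)]
  have h1 : w * w ^ (p - 1) = w ^ (p - 1 / 2) * Real.sqrt w := by
    rw [Real.sqrt_eq_rpow, ← Real.rpow_add hw0, mul_comm, ← Real.rpow_add_one hw0.ne']
    congr 1; ring
  have h2 : w ^ (p - 1 / 2) = |x| ^ (p - 1 / 2) / 2 ^ (p - 1 / 2) * Real.exp ((p - 1 / 2) * t) := by
    rw [hw, Real.mul_rpow (by positivity) (by positivity), Real.div_rpow (by positivity)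
      (by positivity), ← Real.exp_mul, mul_comm t]
  have h3 : Real.sqrt (2 * Real.pi * (2 * w)) = 2 * Real.sqrt Real.pi * Real.sqrt w := by
    rw [show 2 * Real.pi * (2 * w) = 2 ^ 2 * Real.pi * w by ring, Real.sqrt_mul (by positivity),
      Real.sqrt_mul (by positivity), Real.sqrt_sq (by positivity)]
  have h4 : Real.exp (-w) * Real.exp (-(x - 0) ^ 2 / (2 * (2 * w))) =
      Real.exp (-|x| * Real.cosh t) := by
    rw [← Real.exp_add]
    congr 1
    rw [Real.cosh_eq, hw, Real.exp_neg, sub_zero, ← sq_abs x]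
    field_simp
    ring
  have hs : 0 < Real.sqrt w := Real.sqrt_pos.2 hw0
  rw [h3, Real.exp_add, ← h4]
  calc _ = w * w ^ (p - 1) * (1 / Real.Gamma p * (2 * Real.sqrt Real.pi * Real.sqrt w)⁻¹) *
        (Real.exp (-w) * Real.exp (-(x - 0) ^ 2 / (2 * (2 * w)))) := by ring
    _ = _ := by
      rw [h1, h2]
      field_simp

lemma measurable_uncurry_gaussianMix_density :
    Measurable fun z : ℝ × ℝ => gaussianPDF 0 (2 * z.1).toNNReal z.2 :=
  measurable_uncurry_gaussianPDF.comp (by fun_prop : Measurable fun z : ℝ × ℝ =>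
    ((0 : ℝ), (2 * z.1).toNNReal, z.2))

lemma ae_pos_gammaMeasure (p : ℝ) : ∀ᵐ w ∂(gammaMeasure p 1), 0 < w := by
  have h := lintegral_gammaMeasure p (f := Set.indicator (Set.Iic 0) 1)
    (measurable_one.indicator measurableSet_Iic)
  rw [lintegral_indicator_one measurableSet_Iic, setLIntegral_congr_fun (g := fun _ => 0)
    measurableSet_Ioi, lintegral_zero] at h
  · rw [ae_iff]
    simpa [Set.Iic] using h
  · intro w hw
    simp [Set.mem_Ioi.1 hw]

/-- For `x ≠ 0` the Gaussian mixture density is a `lintegral` version of the Bessel-K density. -/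
lemma lintegral_gaussianPDF_gammaMeasure {p x : ℝ} (hp : 0 < p) (hx : x ≠ 0) :
    ∫⁻ w, gaussianPDF 0 (2 * w).toNNReal x ∂(gammaMeasure p 1) =
      ENNReal.ofReal (1 / (Real.sqrt Real.pi * Real.Gamma p * 2 ^ (p - 1 / 2)) *
        |x| ^ (p - 1 / 2)) *
      ∫⁻ t in Set.Ioi 0, ENNReal.ofReal
        (Real.exp (-|x| * Real.cosh t) * Real.cosh ((p - 1 / 2) * t)) := by
  have hΓ := Real.Gamma_pos_of_pos hp
  have hx' : 0 < |x| := abs_pos.2 hx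
  have hm : Measurable fun w : ℝ => gaussianPDF 0 (2 * w).toNNReal x :=
    measurable_uncurry_gaussianMix_density.comp (by fun_prop : Measurable fun w : ℝ => (w, x))
  rw [lintegral_gammaMeasure _ hm,
    lintegral_Ioi_comp_mul_exp (c := |x| / 2) (by positivity)]
  have : ∀ t : ℝ, ENNReal.ofReal (|x| / 2 * Real.exp t) *
      (ENNReal.ofReal (1 / Real.Gamma p * (|x| / 2 * Real.exp t) ^ (p - 1) *
          Real.exp (-(|x| / 2 * Real.exp t))) *
        gaussianPDF 0 (2 * (|x| / 2 * Real.exp t)).toNNReal x) =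
      ENNReal.ofReal (1 / (Real.sqrt Real.pi * Real.Gamma p * 2 ^ (p - 1 / 2)) *
        |x| ^ (p - 1 / 2)) *
        ENNReal.ofReal (2⁻¹ * Real.exp (-|x| * Real.cosh t + (p - 1 / 2) * t)) := fun t => by
    rw [gaussianPDF, ← ENNReal.ofReal_mul (by positivity), ← ENNReal.ofReal_mul (by positivity),
      ← ENNReal.ofReal_mul (by positivity), gaussianMix_integrand hx]
  simp_rw [this]
  rw [lintegral_const_mul _ (by fun_prop)]
  congr 1
  rw [lintegral_eq_lintegral_Ioi_add_neg _ (by fun_prop)]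
  refine lintegral_congr fun t => ?_
  rw [← ENNReal.ofReal_add (by positivity) (by positivity), Real.cosh_neg, Real.exp_add,
    Real.exp_add, Real.cosh_eq ((p - 1 / 2) * t), mul_neg]
  congr 1
  ring

/-- The Bessel-K distribution is a gamma mixture of centred Gaussians. -/
theorem besselK_eq_bind {p : ℝ} (hp : 0 < p) :
    besselK p 1 = (gammaMeasure p 1).bind gaussianMixKernel := by
  have : IsProbabilityMeasure (gammaMeasure p 1) := isProbabilityMeasure_gammaMeasure hp one_pos
  have hm : Measurable fun z : ℝ × ℝ => gaussianPDF 0 (2 * z.1).toNNReal z.2 :=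
    measurable_uncurry_gaussianMix_density
  have hset : ∀ s, MeasurableSet s → (gammaMeasure p 1).bind gaussianMixKernel s =
      ∫⁻ x in s, ∫⁻ w, gaussianPDF 0 (2 * w).toNNReal x ∂(gammaMeasure p 1) := by
    intro s hs
    rw [Measure.bind_apply hs gaussianMixKernel.aemeasurable,
      ← lintegral_lintegral_swap (by exact hm.aemeasurable)]
    refine lintegral_congr_ae ?_
    -- At w ≤ 0 the kernel is a Dirac mass and has no density.
    filter_upwards [ae_pos_gammaMeasure p] with w hw
    rw [gaussianMixKernel_apply, gaussianReal_apply _ (by simpa using hw)]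
  -- The mixture has total mass one, so its density is finite almost everywhere. This yields
  -- finiteness of the Bessel integral, needed to identify the Bochner integral in `modifiedBesselK`
  -- with the `lintegral`.
  have hfin : ∀ᵐ x, ∫⁻ w, gaussianPDF 0 (2 * w).toNNReal x ∂(gammaMeasure p 1) < ∞ := by
    refine ae_lt_top (by exact hm.lintegral_prod_left') ?_
    rw [← setLIntegral_univ, ← hset _ MeasurableSet.univ]
    exact measure_ne_top _ _
  ext s hs
  rw [hset s hs, besselK, withDensity_apply _ hs]
  refine setLIntegral_congr_fun_ae hs ?_
  filter_upwards [hfin, Measure.ae_ne volume (0 : ℝ)] with x hx hx0 _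
  rw [lintegral_gaussianPDF_gammaMeasure hp hx0] at hx ⊢
  have hΓ := Real.Gamma_pos_of_pos hp
  have hc : 0 < 1 / (Real.sqrt Real.pi * Real.Gamma p * 2 ^ (p - 1 / 2)) * |x| ^ (p - 1 / 2) := by
    have := abs_pos.2 hx0
    positivity
  have hK : ∫⁻ t in Set.Ioi 0, ENNReal.ofReal
      (Real.exp (-|x| * Real.cosh t) * Real.cosh ((p - 1 / 2) * t)) ≠ ∞ :=
    (ENNReal.lt_top_of_mul_ne_top_right hx.ne (by simpa using hc)).ne
  rw [besselKPDF, modifiedBesselK, div_one, Real.one_rpow, mul_one,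
    integral_eq_lintegral_of_nonneg_ae (ae_of_all _ fun t => by positivity)
      (by fun_prop : Continuous _).aestronglyMeasurable,
    ENNReal.ofReal_mul hc.le, ENNReal.ofReal_toReal hK]

lemma isProbabilityMeasure_besselK {p : ℝ} (hp : 0 < p) : IsProbabilityMeasure (besselK p 1) := by
  have : IsProbabilityMeasure (gammaMeasure p 1) := isProbabilityMeasure_gammaMeasure hp one_pos
  rw [besselK_eq_bind hp]
  infer_instance

/-! ### Second moment and characteristic function of Bessel-K -/

lemma lintegral_sq_gaussianReal (v : ℝ≥0) :
    ∫⁻ x, ENNReal.ofReal (x ^ 2) ∂(gaussianReal 0 v) = v := by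
  rw [← ofReal_integral_eq_lintegral_ofReal
    (f := fun x => x ^ 2) ((memLp_id_gaussianReal 2).integrable_sq) (ae_of_all _ fun x => by positivity)]
  have h := variance_fun_id_gaussianReal (μ := 0) (v := v)
  rw [variance_eq_integral (by fun_prop), integral_id_gaussianReal] at h
  simp only [sub_zero] at h
  simp [h]

lemma lintegral_id_gammaMeasure_lt_top {p : ℝ} (hp : 0 < p) :
    ∫⁻ w, ENNReal.ofReal w ∂(gammaMeasure p 1) < ∞ := by
  have hΓ := Real.Gamma_pos_of_pos hp
  rw [lintegral_gammaMeasure _ (by fun_prop),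
    setLIntegral_congr_fun (g := fun w => ENNReal.ofReal
      (1 / Real.Gamma p * (Real.exp (-w) * w ^ (p + 1 - 1)))) measurableSet_Ioi,
    ← ofReal_integral_eq_lintegral_ofReal]
  · exact ENNReal.ofReal_lt_top
  · exact (Real.GammaIntegral_convergent (by positivity)).const_mul _
  · filter_upwards [ae_restrict_mem measurableSet_Ioi] with w hw
    have : 0 < w := hw
    simp only [Pi.zero_apply]
    positivity
  · intro w hw
    have : 0 < w := hw
    simp only
    rw [← ENNReal.ofReal_mul (by positivity), add_sub_right_comm, Real.rpow_add_one this.ne']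
    congr 1
    ring

lemma lintegral_sq_besselK_lt_top {p : ℝ} (hp : 0 < p) :
    ∫⁻ x, ENNReal.ofReal (x ^ 2) ∂(besselK p 1) < ∞ := by
  rw [besselK_eq_bind hp, Measure.lintegral_bind gaussianMixKernel.aemeasurable (by fun_prop)]
  simp_rw [gaussianMixKernel_apply, lintegral_sq_gaussianReal]
  have : ∀ w : ℝ, (((2 * w).toNNReal : ℝ≥0) : ℝ≥0∞) = 2 * ENNReal.ofReal w := fun w => by
    change ENNReal.ofReal (2 * w) = _
    rw [ENNReal.ofReal_mul (by norm_num)]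
    simp
  simp_rw [this]
  rw [lintegral_const_mul _ (by fun_prop)]
  exact ENNReal.mul_lt_top (by simp) (lintegral_id_gammaMeasure_lt_top hp)

lemma integral_exp_neg_mul_gammaMeasure {p s : ℝ} (hp : 0 < p) (hs : 0 ≤ s) :
    ∫ w, Real.exp (-(s * w)) ∂(gammaMeasure p 1) = (1 + s) ^ (-p) := by
  have hΓ := Real.Gamma_pos_of_pos hp
  rw [integral_eq_lintegral_of_nonneg_ae (ae_of_all _ fun w => by positivity)
    (by fun_prop : Continuous _).aestronglyMeasurable, lintegral_gammaMeasure _ (by fun_prop),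
    setLIntegral_congr_fun (g := fun w => ENNReal.ofReal
      (1 / Real.Gamma p * (w ^ (p - 1) * Real.exp (-((1 + s) * w))))) measurableSet_Ioi,
    ← integral_eq_lintegral_of_nonneg_ae, integral_const_mul,
    Real.integral_rpow_mul_exp_neg_mul_Ioi hp (by positivity)]
  · rw [one_div_mul_eq_div, mul_div_assoc, div_self hΓ.ne', mul_one, one_div,
      Real.inv_rpow (by positivity), Real.rpow_neg (by positivity)]
  · filter_upwards [ae_restrict_mem measurableSet_Ioi] with w hw
    have : 0 < w := hw
    simp only [Pi.zero_apply]
    positivity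
  · exact (by fun_prop : Measurable _).aestronglyMeasurable
  · intro w hw
    have : 0 < w := hw
    simp only
    rw [← ENNReal.ofReal_mul (by positivity), add_mul, one_mul, neg_add, Real.exp_add]
    congr 1
    ring

theorem charFun_besselK {p : ℝ} (hp : 0 < p) (t : ℝ) :
    charFun (besselK p 1) t = (((1 + t ^ 2) ^ (-p) : ℝ) : ℂ) := by
  have : IsProbabilityMeasure (gammaMeasure p 1) := isProbabilityMeasure_gammaMeasure hp one_pos
  have hi : Integrable (fun x : ℝ => Complex.exp (t * x * Complex.I))
      ((gammaMeasure p 1).bind gaussianMixKernel) :=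
    (integrable_const (1 : ℝ)).mono (by fun_prop) (ae_of_all _ fun x => by
      rw [← Complex.ofReal_mul, Complex.norm_exp_ofReal_mul_I]; simp)
  rw [charFun_apply_real, besselK_eq_bind hp, Measure.comp_eq_comp_const_apply,
    Kernel.integral_comp (by rwa [← Measure.comp_eq_comp_const_apply]), Kernel.const_apply,
    ← integral_exp_neg_mul_gammaMeasure hp (sq_nonneg t), ← integral_complex_ofReal]
  refine integral_congr_ae ?_
  filter_upwards [ae_pos_gammaMeasure p] with w hw
  rw [gaussianMixKernel_apply, ← charFun_apply_real, charFun_gaussianReal,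
    Real.coe_toNNReal _ (by positivity)]
  push_cast
  congr 1
  ring

/-! ### Characteristic function of the compound Poisson innovation -/

lemma integral_prod_infinitePi {ι : Type*} {μ : ι → Measure ℝ} [∀ i, IsProbabilityMeasure (μ i)]
    (s : Finset ι) {f : ι → ℝ → ℂ} (hf : ∀ i, Measurable (f i)) :
    ∫ ω, ∏ i ∈ s, f i (ω i) ∂(Measure.infinitePi μ) = ∏ i ∈ s, ∫ x, f i x ∂(μ i) := by
  have h := integral_restrict_infinitePi (μ := μ) (s := s)
    (f := fun y : (∀ i : s, ℝ) => ∏ i : s, f i (y i))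
    (by fun_prop : Measurable _).aestronglyMeasurable
  simp only [Finset.restrict] at h
  rw [integral_fintype_prod_eq_prod (fun (i : s) => f i)] at h
  rw [← Finset.prod_coe_sort s (fun i => ∫ x, f i x ∂(μ i)), ← h]
  refine integral_congr_ae (ae_of_all _ fun ω => ?_)
  exact (Finset.prod_coe_sort s (fun i => f i (ω i))).symm

instance isProbabilityMeasure_uniform_Icc :
    IsProbabilityMeasure ((volume : Measure ℝ).restrict (Set.Icc 0 1)) := ⟨by simp⟩

instance isProbabilityMeasure_expMeasure_one : IsProbabilityMeasure (expMeasure (1 / 1)) :=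
  isProbabilityMeasure_expMeasure (by norm_num)

lemma charFun_expMeasure_one (s : ℝ) :
    charFun (expMeasure (1 / 1)) s = 1 / (1 - s * Complex.I) := by
  have hm : Measurable (gammaPDF 1 1) := (measurable_gammaPDFReal 1 1).ennreal_ofReal
  rw [charFun_apply_real, div_one, expMeasure, gammaMeasure,
    integral_withDensity_eq_integral_toReal_smul hm (ae_of_all _ fun x => ENNReal.ofReal_lt_top),
    ← setIntegral_eq_integral_of_ae_compl_eq_zero (s := Set.Ioi 0)]
  · rw [setIntegral_congr_fun (g := fun x : ℝ => Complex.exp ((s * Complex.I - 1) * x))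
      measurableSet_Ioi, integral_exp_mul_complex_Ioi (by simp)]
    · rw [← neg_sub (1 : ℂ), neg_div_neg_eq]
      simp
    · intro x hx
      have hx : 0 < x := hx
      simp only
      rw [gammaPDF_of_nonneg hx.le, ENNReal.toReal_ofReal (by simp; positivity)]
      simp only [Real.one_rpow, Real.Gamma_one, sub_self, Real.rpow_zero, one_mul, div_one,
        Complex.real_smul, Complex.ofReal_exp]
      rw [← Complex.exp_add]
      congr 1
      push_cast
      ring
  · filter_upwards [Measure.ae_ne volume (0 : ℝ)] with x hx0 hx
    rw [gammaPDF_of_neg (lt_of_le_of_ne (not_lt.1 hx) hx0)]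
    simp

/-- The characteristic function of `β ^ U * θ` with `U` uniform and `θ` exponential. -/
def jumpCharFun (β t : ℝ) : ℂ :=
  ∫ u in Set.Icc (0 : ℝ) 1, 1 / (1 - (t * β ^ u : ℝ) * Complex.I)

lemma norm_one_div_one_sub_mul_I_le (s : ℝ) : ‖1 / (1 - s * Complex.I)‖ ≤ 1 := by
  rw [← charFun_expMeasure_one]
  exact norm_charFun_le_one s

/-- Conditionally on the uniforms, the exponentials contribute independent factors 1/(1 - i t β^u);
integrating these over the uniforms gives n equal factors. -/
lemma integral_compoundSum (β t : ℝ) (n : ℕ) :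
    ∫ z : (ℕ → ℝ) × (ℕ → ℝ),
        Complex.exp (t * (∑ k ∈ Finset.range n, β ^ (z.1 k) * z.2 k : ℝ) * Complex.I)
      ∂((Measure.infinitePi fun _ : ℕ => (volume : Measure ℝ).restrict (Set.Icc 0 1)).prod
        (Measure.infinitePi fun _ : ℕ => expMeasure (1 / 1))) = jumpCharFun β t ^ n := by
  have hm : ∀ z : (ℕ → ℝ) × (ℕ → ℝ), ‖Complex.exp
      (t * (∑ k ∈ Finset.range n, β ^ (z.1 k) * z.2 k : ℝ) * Complex.I)‖ ≤ ‖(1 : ℝ)‖ := fun z => by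
    rw [← Complex.ofReal_mul, Complex.norm_exp_ofReal_mul_I]; simp
  rw [integral_prod _ ((integrable_const (1 : ℝ)).mono
    (by fun_prop : Measurable _).aestronglyMeasurable (ae_of_all _ hm))]
  have h1 : ∀ u : ℕ → ℝ, ∫ θ : ℕ → ℝ,
      Complex.exp (t * (∑ k ∈ Finset.range n, β ^ (u k) * θ k : ℝ) * Complex.I)
        ∂(Measure.infinitePi fun _ : ℕ => expMeasure (1 / 1)) =
      ∏ k ∈ Finset.range n, 1 / (1 - (t * β ^ (u k) : ℝ) * Complex.I) := fun u => by
    simp_rw [← charFun_expMeasure_one, charFun_apply_real]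
    rw [← integral_prod_infinitePi (Finset.range n) (f := fun k (x : ℝ) =>
      Complex.exp ((t * β ^ (u k) : ℝ) * x * Complex.I)) (fun k => by fun_prop)]
    refine integral_congr_ae (ae_of_all _ fun θ => ?_)
    simp only
    rw [← Complex.exp_sum]
    congr 1
    push_cast
    rw [Finset.mul_sum, Finset.sum_mul]
    exact Finset.sum_congr rfl fun k _ => by ring
  simp only [h1]
  rw [integral_prod_infinitePi (μ := fun _ : ℕ => (volume : Measure ℝ).restrict (Set.Icc 0 1))
    (Finset.range n) (f := fun _ (x : ℝ) => 1 / (1 - (t * β ^ x : ℝ) * Complex.I))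
    (fun k => by fun_prop)]
  simp [jumpCharFun]

lemma measurable_compoundSum (β : ℝ) :
    Measurable fun ω : ℕ × (ℕ → ℝ) × (ℕ → ℝ) =>
      ∑ k ∈ Finset.range ω.1, β ^ (ω.2.1 k) * ω.2.2 k :=
  measurable_from_prod_countable_right fun n => by
    simp only
    fun_prop

instance isProbabilityMeasure_gammaInnovation (β p : ℝ) :
    IsProbabilityMeasure (gammaInnovation β p 1) :=
  Measure.isProbabilityMeasure_map (measurable_compoundSum β).aemeasurable

instance isProbabilityMeasure_besselKInnovation (β p : ℝ) :
    IsProbabilityMeasure (besselKInnovation β p 1) :=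
  Measure.isProbabilityMeasure_map (by fun_prop)

/-- Conditioning on τ = n gives the n-th power of the jump characteristic function, and the Poisson
weights sum these to an exponential. -/
lemma charFun_gammaInnovation (β p t : ℝ) :
    charFun (gammaInnovation β p 1) t =
      Complex.exp ((p * Real.log (1 / β)).toNNReal * (jumpCharFun β t - 1)) := by
  set r := (p * Real.log (1 / β)).toNNReal with hr
  have hm : Measurable fun ω : ℕ × (ℕ → ℝ) × (ℕ → ℝ) => Complex.exp
      (t * (∑ k ∈ Finset.range ω.1, β ^ (ω.2.1 k) * ω.2.2 k : ℝ) * Complex.I) := by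
    have := measurable_compoundSum β
    fun_prop
  rw [charFun_apply_real, gammaInnovation,
    integral_map (measurable_compoundSum β).aemeasurable (by fun_prop), integral_prod]
  · simp_rw [integral_compoundSum]
    rw [← hr, integral_poissonMeasure]
    calc ∑' n : ℕ, (Real.exp (-r) * r ^ n / n.factorial) • jumpCharFun β t ^ n
        = ∑' n : ℕ, (Real.exp (-r) : ℂ) * ((r * jumpCharFun β t) ^ n / n.factorial) := by
          congr with n
          rw [Complex.real_smul, mul_pow]
          push_cast
          ring
      _ = Real.exp (-r) * Complex.exp (r * jumpCharFun β t) := by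
          rw [tsum_mul_left, (NormedSpace.expSeries_div_hasSum_exp (r * jumpCharFun β t)).tsum_eq,
            Complex.exp_eq_exp_ℂ]
      _ = _ := by
          rw [Complex.ofReal_exp, ← Complex.exp_add]
          push_cast
          ring_nf
  · refine (integrable_const (1 : ℝ)).mono hm.aestronglyMeasurable (ae_of_all _ fun z => ?_)
    rw [← Complex.ofReal_mul, Complex.norm_exp_ofReal_mul_I]; simp

lemma re_jumpCharFun {β : ℝ} (hβ : 0 < β) (t : ℝ) :
    (jumpCharFun β t).re = ∫ u in (0 : ℝ)..1, 1 / (1 + t ^ 2 * β ^ (2 * u)) := by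
  rw [jumpCharFun, ← RCLike.re_eq_complex_re, ← integral_re, intervalIntegral.integral_of_le
    zero_le_one, integral_Icc_eq_integral_Ioc]
  · refine integral_congr_ae (ae_of_all _ fun u => ?_)
    have h : β ^ (2 * u) = β ^ u * β ^ u := by rw [two_mul, Real.rpow_add hβ]
    simp [h, Complex.normSq_apply]
    ring
  · refine (integrable_const (1 : ℝ)).mono (by fun_prop : Measurable _).aestronglyMeasurable
      (ae_of_all _ fun u => ?_)
    simpa using norm_one_div_one_sub_mul_I_le (t * β ^ u)

lemma two_mul_log_mul_re_jumpCharFun {β : ℝ} (hβ : 0 < β) (t : ℝ) :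
    2 * Real.log (1 / β) * ((jumpCharFun β t).re - 1) =
      Real.log (1 + t ^ 2 * β ^ 2) - Real.log (1 + t ^ 2) := by
  -- With y = t² β^(2u), the derivative of log(1 + y) is 2 log β · y/(1 + y); subtracting 2 log β
  -- leaves -2 log β/(1 + y), a multiple of the integrand of `re_jumpCharFun`.
  have hd : ∀ u : ℝ, HasDerivAt (fun u => Real.log (1 + t ^ 2 * β ^ (2 * u)) - 2 * Real.log β * u)
      (2 * Real.log (1 / β) * (1 / (1 + t ^ 2 * β ^ (2 * u)))) u := fun u => by
    have hpos : 0 < 1 + t ^ 2 * β ^ (2 * u) := by positivity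
    have h := (((((hasDerivAt_id u).const_mul 2).const_rpow hβ).const_mul (t ^ 2)).const_add
      1).log hpos.ne' |>.sub ((hasDerivAt_id u).const_mul (2 * Real.log β))
    refine h.congr_deriv ?_
    simp only [id]
    rw [one_div, Real.log_inv]
    field_simp
    ring
  have hc : Continuous fun u : ℝ => 2 * Real.log (1 / β) * (1 / (1 + t ^ 2 * β ^ (2 * u))) := by
    refine continuous_const.mul (continuous_const.div ?_ fun u => by positivity)
    exact continuous_const.add (continuous_const.mul
      (continuous_const.rpow (by fun_prop) fun u => Or.inl hβ.ne'))
  have h := intervalIntegral.integral_eq_sub_of_hasDerivAt (fun u _ => hd u)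
    (hc.intervalIntegrable 0 1)
  rw [intervalIntegral.integral_const_mul, ← re_jumpCharFun hβ] at h
  rw [mul_sub, h]
  simp only [mul_one, mul_zero, Real.rpow_zero, sub_zero, one_div, Real.log_inv, Real.rpow_two]
  ring

/-- Symmetrising gives φ(t) φ(-t) = |φ(t)|², so only the real part of the jump characteristic
function enters. -/
theorem charFun_besselKInnovation {β p : ℝ} (hβ : β ∈ Set.Ioo (0 : ℝ) 1) (hp : 0 < p) (t : ℝ) :
    charFun (besselKInnovation β p 1) t =
      (((1 + t ^ 2 * β ^ 2) ^ p * (1 + t ^ 2) ^ (-p) : ℝ) : ℂ) := by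
  -- The Poisson rate is nonnegative, so `toNNReal` does not truncate it.
  have hr : 0 ≤ p * Real.log (1 / β) :=
    mul_nonneg hp.le (Real.log_nonneg (by rw [one_div]; exact (one_le_inv₀ hβ.1).2 hβ.2.le))
  have h1 : charFun (besselKInnovation β p 1) t =
      charFun (gammaInnovation β p 1) t * charFun (gammaInnovation β p 1) (-t) := by
    rw [besselKInnovation, charFun_apply_real, integral_map (by fun_prop) (by fun_prop),
      charFun_apply_real, charFun_apply_real, ← integral_prod_mul]
    refine integral_congr_ae (ae_of_all _ fun x => ?_)
    simp only
    rw [← Complex.exp_add]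
    congr 1
    push_cast
    ring
  rw [h1, charFun_neg, Complex.mul_conj, charFun_gammaInnovation, Complex.normSq_eq_norm_sq,
    Complex.norm_exp]
  congr 1
  have h2 : (((p * Real.log (1 / β)).toNNReal : ℂ) * (jumpCharFun β t - 1)).re =
      p * Real.log (1 / β) * ((jumpCharFun β t).re - 1) := by
    rw [show (((p * Real.log (1 / β)).toNNReal : ℝ≥0) : ℂ) = ((p * Real.log (1 / β) : ℝ) : ℂ) by
      rw [← Real.coe_toNNReal _ hr]; simp, Complex.re_ofReal_mul]
    simp
  rw [h2, ← Real.exp_nat_mul, Real.rpow_def_of_pos (by positivity),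
    Real.rpow_def_of_pos (by positivity), ← Real.exp_add]
  congr 1
  have := two_mul_log_mul_re_jumpCharFun hβ.1 t
  push_cast
  linear_combination p * this

/-- On the characteristic function level, `BK_β(p, 1)` is an innovation of `BK(p, 1)`. -/
theorem charFun_besselK_eq_mul {β p : ℝ} (hβ : β ∈ Set.Ioo (0 : ℝ) 1) (hp : 0 < p) (t : ℝ) :
    charFun (besselK p 1) t =
      charFun (besselK p 1) (β * t) * charFun (besselKInnovation β p 1) t := by
  rw [charFun_besselK hp, charFun_besselK hp, charFun_besselKInnovation hβ hp,
    ← Complex.ofReal_mul, ← mul_assoc, mul_pow, mul_comm (β ^ 2), ← Real.rpow_add (by positivity)]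
  simp

/-! ### Second moment of the innovation -/

lemma lintegral_sq_lt_top_of_conv {μ ν : Measure ℝ} [IsProbabilityMeasure μ]
    [IsFiniteMeasure ν]
    (h : ∫⁻ x, ENNReal.ofReal (x ^ 2) ∂(μ.conv ν) < ∞) :
    ∫⁻ y, ENNReal.ofReal (y ^ 2) ∂ν < ∞ := by
  rw [Measure.lintegral_conv (by fun_prop)] at h
  -- By Tonelli some translate of ν has finite second moment; undoing the translation costs only a
  -- constant.
  obtain ⟨x, hx⟩ := (ae_lt_top (by fun_prop) h.ne).exists
  have hle : ∀ y : ℝ, ENNReal.ofReal (y ^ 2) ≤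
      2 * ENNReal.ofReal ((x + y) ^ 2) + 2 * ENNReal.ofReal (x ^ 2) := fun y => by
    rw [show (2 : ℝ≥0∞) = ENNReal.ofReal 2 by simp, ← ENNReal.ofReal_mul (by norm_num),
      ← ENNReal.ofReal_mul (by norm_num), ← ENNReal.ofReal_add (by positivity) (by positivity)]
    -- The difference of the two sides is exactly (2x + y)².
    exact ENNReal.ofReal_le_ofReal (by nlinarith [sq_nonneg (2 * x + y)])
  refine (lintegral_mono hle).trans_lt ?_
  rw [lintegral_add_right _ measurable_const, lintegral_const_mul _ (by fun_prop),
    lintegral_const]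
  exact ENNReal.add_lt_top.2 ⟨ENNReal.mul_lt_top (by simp) hx,
    ENNReal.mul_lt_top (ENNReal.mul_lt_top (by simp) (by simp)) (measure_lt_top _ _)⟩

/-- BK is the convolution of its β-dilation with the innovation, so the innovation inherits the
finite second moment of BK. -/
theorem lintegral_sq_besselKInnovation_lt_top {β p : ℝ} (hβ : β ∈ Set.Ioo (0 : ℝ) 1)
    (hp : 0 < p) : ∫⁻ x, ENNReal.ofReal (x ^ 2) ∂(besselKInnovation β p 1) < ∞ := by
  have := isProbabilityMeasure_besselK hp
  have : IsProbabilityMeasure ((besselK p 1).map (β * ·)) :=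
    Measure.isProbabilityMeasure_map (by fun_prop)
  have h : besselK p 1 = ((besselK p 1).map (β * ·)).conv (besselKInnovation β p 1) := by
    refine Measure.ext_of_charFun (funext fun t => ?_)
    rw [charFun_conv, charFun_map_mul, charFun_besselK_eq_mul hβ hp]
  have hlt := lintegral_sq_besselK_lt_top hp
  rw [h] at hlt
  exact lintegral_sq_lt_top_of_conv hlt

/-! ### Random series in the Hilbert space -/

section RandomSeries

variable {X : Type*} [NormedAddCommGroup X] [InnerProductSpace ℝ X] {ι : Type*} {R : X →L[ℝ] X}

/-- Expanding x in the eigenbasis and using continuity of R replaces any appeal to self-adjointness.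
-/
lemma EigenSystem.inner_eigenvector_apply (E : EigenSystem ι R) (k : ι) (x : X) :
    inner ℝ (E.eigenvector k) (R x) = E.eigenvalue k * inner ℝ (E.eigenvector k) x := by
  classical
  have h := (E.eigenvector.hasSum_repr x).mapL ((innerSL ℝ (E.eigenvector k)).comp R)
  have h0 : ∀ j ≠ k, ((innerSL ℝ (E.eigenvector k)).comp R)
      (E.eigenvector.repr x j • E.eigenvector j) = 0 := fun j hj => by
    simp [E.apply_eigenvector, E.eigenvector.orthonormal.2 hj.symm]
  have h1 := h.unique (hasSum_single k h0)
  simp only [ContinuousLinearMap.comp_apply, innerSL_apply_apply, map_smul, E.apply_eigenvector,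
    E.eigenvector.repr_apply_apply, real_inner_self_eq_norm_sq,
    E.eigenvector.orthonormal.1 k] at h1
  rw [h1]
  simp [mul_comm]

lemma tsum_ofReal_inner_sq {κ : Type*} (b : HilbertBasis κ ℝ X) (x : X) :
    ∑' i, ENNReal.ofReal (inner ℝ (b i) x ^ 2) = ENNReal.ofReal (‖x‖ ^ 2) := by
  have h := b.hasSum_inner_mul_inner x x
  have h' : HasSum (fun i => inner ℝ (b i) x ^ 2) (‖x‖ ^ 2) := by
    rw [← real_inner_self_eq_norm_sq]
    refine h.congr_fun fun i => ?_
    rw [real_inner_comm x, sq]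
  rw [← h'.tsum_eq, ENNReal.ofReal_tsum_of_nonneg (fun i => sq_nonneg _) h'.summable]

/-- The eigenvalues of a Hilbert–Schmidt operator are square summable. -/
lemma EigenSystem.summable_sq_eigenvalue (E : EigenSystem ι R) (hR : IsHilbertSchmidt R) :
    Summable fun k => E.eigenvalue k ^ 2 := by
  obtain ⟨s, e, he⟩ := hR
  have key : ∑' k, ENNReal.ofReal (E.eigenvalue k ^ 2) =
      ∑' i, ENNReal.ofReal (‖R (e i)‖ ^ 2) := by
    -- Parseval in both bases: the Hilbert–Schmidt sum does not depend on the basis, and in the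
    -- eigenbasis it is ∑ γ_k².
    calc ∑' k, ENNReal.ofReal (E.eigenvalue k ^ 2)
        = ∑' k, ∑' i, ENNReal.ofReal (E.eigenvalue k ^ 2) *
            ENNReal.ofReal (inner ℝ (e i) (E.eigenvector k) ^ 2) := by
          congr with k
          rw [ENNReal.tsum_mul_left, tsum_ofReal_inner_sq,
            E.eigenvector.orthonormal.1 k]
          simp
      _ = ∑' i, ∑' k, ENNReal.ofReal (inner ℝ (E.eigenvector k) (R (e i)) ^ 2) := by
          rw [ENNReal.tsum_comm]
          congr with i
          congr with k
          rw [← ENNReal.ofReal_mul (sq_nonneg _), E.inner_eigenvector_apply,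
            real_inner_comm (e i), mul_pow]
      _ = _ := by
          congr with i
          rw [tsum_ofReal_inner_sq]
  have hlt : ∑' k, ENNReal.ofReal (E.eigenvalue k ^ 2) ≠ ∞ := by
    rw [key, ← ENNReal.ofReal_tsum_of_nonneg (fun i => sq_nonneg _) he]
    exact ENNReal.ofReal_ne_top
  refine (ENNReal.summable_toReal hlt).congr fun k => ?_
  rw [ENNReal.toReal_ofReal (sq_nonneg _)]

variable [CompleteSpace X]

lemma EigenSystem.summable_series (E : EigenSystem ι R) {ξ : ι → ℝ}
    (h : Summable fun k => (E.eigenvalue k * ξ k) ^ 2) :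
    Summable fun k => (E.eigenvalue k * ξ k) • E.eigenvector k := by
  have := (E.eigenvector.orthonormal.orthogonalFamily.summable_iff_norm_sq_summable
    (fun k => E.eigenvalue k * ξ k)).2 (by simpa only [Real.norm_eq_abs, sq_abs] using h)
  simpa using this

variable [Countable ι]

/-- Almost sure convergence of the random series for square integrable coefficients. -/
lemma EigenSystem.ae_summable (E : EigenSystem ι R) (hE : Summable fun k => E.eigenvalue k ^ 2)
    {ν : Measure ℝ} [IsProbabilityMeasure ν] (hν : ∫⁻ x, ENNReal.ofReal (x ^ 2) ∂ν < ∞) :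
    ∀ᵐ η ∂(Measure.infinitePi fun _ : ι => ν),
      Summable fun k => (E.eigenvalue k * η k) • E.eigenvector k := by
  -- The expected squared norm is (∑ γ_k²) times the second moment of ν, so the sum of squares is
  -- almost surely finite; orthogonality then gives summability.
  have hint : ∫⁻ η, ∑' k, ENNReal.ofReal ((E.eigenvalue k * η k) ^ 2)
      ∂(Measure.infinitePi fun _ : ι => ν) ≠ ∞ := by
    rw [lintegral_tsum fun k => (by fun_prop : Measurable _).aemeasurable]
    have h1 : ∀ k, ∫⁻ η, ENNReal.ofReal ((E.eigenvalue k * η k) ^ 2)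
        ∂(Measure.infinitePi fun _ : ι => ν) =
        ENNReal.ofReal (E.eigenvalue k ^ 2) * ∫⁻ x, ENNReal.ofReal (x ^ 2) ∂ν := fun k => by
      rw [← (measurePreserving_eval_infinitePi (fun _ : ι => ν) k).lintegral_comp (by fun_prop),
        ← lintegral_const_mul _ (by fun_prop)]
      refine lintegral_congr fun η => ?_
      rw [← ENNReal.ofReal_mul (sq_nonneg _), mul_pow]
    simp_rw [h1]
    rw [ENNReal.tsum_mul_right, ← ENNReal.ofReal_tsum_of_nonneg (fun i => sq_nonneg _) hE]
    exact ENNReal.mul_ne_top ENNReal.ofReal_ne_top hν.ne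
  filter_upwards [ae_lt_top (by fun_prop) hint] with η hη
  refine E.summable_series ((ENNReal.summable_toReal hη.ne).congr fun k => ?_)
  rw [ENNReal.toReal_ofReal (sq_nonneg _)]

variable [TopologicalSpace.SeparableSpace X] [MeasurableSpace X] [BorelSpace X]

/-- The series is an almost everywhere limit of measurable finite sums, along a filter that is
countably generated because ι is countable. -/
lemma EigenSystem.aemeasurable_series (E : EigenSystem ι R)
    (hE : Summable fun k => E.eigenvalue k ^ 2)
    {ν : Measure ℝ} [IsProbabilityMeasure ν] (hν : ∫⁻ x, ENNReal.ofReal (x ^ 2) ∂ν < ∞) :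
    AEMeasurable E.series (Measure.infinitePi fun _ : ι => ν) := by
  have : SecondCountableTopology X := UniformSpace.secondCountable_of_separable X
  refine aemeasurable_of_tendsto_metrizable_ae atTop
    (f := fun (s : Finset ι) η => ∑ k ∈ s, (E.eigenvalue k * η k) • E.eigenvector k)
    (fun s => (by fun_prop : Measurable _).aemeasurable) ?_
  filter_upwards [E.ae_summable hE hν] with η hη
  exact hη.hasSum

lemma EigenSystem.isRadonProbability_map_series (E : EigenSystem ι R)
    (hE : Summable fun k => E.eigenvalue k ^ 2)
    {ν : Measure ℝ} [IsProbabilityMeasure ν] (hν : ∫⁻ x, ENNReal.ofReal (x ^ 2) ∂ν < ∞) :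
    IsRadonProbability ((Measure.infinitePi fun _ : ι => ν).map E.series) := by
  have : SecondCountableTopology X := UniformSpace.secondCountable_of_separable X
  have := Measure.isProbabilityMeasure_map (E.aemeasurable_series hE hν)
  exact ⟨inferInstance, inferInstance, inferInstance, inferInstance⟩

/-- The characteristic functional of a random series is an infinite product. -/
lemma EigenSystem.tendsto_prod_charFun (E : EigenSystem ι R)
    (hE : Summable fun k => E.eigenvalue k ^ 2)
    {ν : Measure ℝ} [IsProbabilityMeasure ν] (hν : ∫⁻ x, ENNReal.ofReal (x ^ 2) ∂ν < ∞)
    (ϱ : StrongDual ℝ X) :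
    Tendsto (fun s : Finset ι => ∏ k ∈ s, charFun ν (E.eigenvalue k * ϱ (E.eigenvector k))) atTop
      (𝓝 (charFunDual ((Measure.infinitePi fun _ : ι => ν).map E.series) ϱ)) := by
  have hprod : ∀ s : Finset ι, ∏ k ∈ s, charFun ν (E.eigenvalue k * ϱ (E.eigenvector k)) =
      ∫ η, Complex.exp (ϱ (∑ k ∈ s, (E.eigenvalue k * η k) • E.eigenvector k) * Complex.I)
        ∂(Measure.infinitePi fun _ : ι => ν) := fun s => by
    simp_rw [charFun_apply_real]
    rw [← integral_prod_infinitePi (μ := fun _ : ι => ν) s (f := fun k (x : ℝ) => Complex.exp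
      ((E.eigenvalue k * ϱ (E.eigenvector k) : ℝ) * x * Complex.I)) (fun k => by fun_prop)]
    refine integral_congr_ae (ae_of_all _ fun η => ?_)
    simp only
    rw [← Complex.exp_sum]
    congr 1
    simp only [map_sum, map_smul, smul_eq_mul]
    push_cast
    rw [Finset.sum_mul]
    exact Finset.sum_congr rfl fun k _ => by ring
  simp_rw [hprod]
  rw [charFunDual_apply, integral_map (E.aemeasurable_series hE hν)
    (by fun_prop : Measurable _).aestronglyMeasurable]
  have : SecondCountableTopology X := UniformSpace.secondCountable_of_separable X
  refine tendsto_integral_filter_of_dominated_convergence (fun _ => (1 : ℝ))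
    (.of_forall fun s => ?_) (.of_forall fun s => ae_of_all _ fun η => ?_)
    (integrable_const _) ?_
  · exact (by fun_prop : Measurable _).aestronglyMeasurable
  · rw [Complex.norm_exp_ofReal_mul_I]
  · filter_upwards [E.ae_summable hE hν] with η hη
    exact ((by fun_prop : Continuous fun x : X => Complex.exp (ϱ x * Complex.I)).tendsto
      _).comp hη.hasSum

/-- Both sides are limits of the same finite products: β may sit with γ_k or with ϱ. -/
lemma EigenSystem.charFunDual_map_series_smul (E : EigenSystem ι R)
    (hE : Summable fun k => E.eigenvalue k ^ 2)
    {ν : Measure ℝ} [IsProbabilityMeasure ν] (hν : ∫⁻ x, ENNReal.ofReal (x ^ 2) ∂ν < ∞)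
    (β : ℝ) (ϱ : StrongDual ℝ X) :
    charFunDual ((Measure.infinitePi fun _ : ι => ν).map (E.smul β).series) ϱ =
      charFunDual ((Measure.infinitePi fun _ : ι => ν).map E.series) (β • ϱ) := by
  have hE' : Summable fun k => (E.smul β).eigenvalue k ^ 2 := by
    simpa only [EigenSystem.smul, mul_pow] using hE.mul_left (β ^ 2)
  refine tendsto_nhds_unique ((E.smul β).tendsto_prod_charFun hE' hν ϱ)
    ((E.tendsto_prod_charFun hE hν (β • ϱ)).congr fun s => Finset.prod_congr rfl fun k _ => ?_)
  simp only [EigenSystem.smul, _root_.smul_apply, smul_eq_mul]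
  congr 1
  ring

/-- Innovations of the coefficients yield innovations of the random series. -/
lemma EigenSystem.isInnovation_map_series (E : EigenSystem ι R)
    (hE : Summable fun k => E.eigenvalue k ^ 2)
    {μ ν : Measure ℝ} [IsProbabilityMeasure μ] [IsProbabilityMeasure ν]
    (hμ : ∫⁻ x, ENNReal.ofReal (x ^ 2) ∂μ < ∞) (hν : ∫⁻ x, ENNReal.ofReal (x ^ 2) ∂ν < ∞)
    {β : ℝ} (h : ∀ t, charFun μ t = charFun μ (β * t) * charFun ν t) :
    IsInnovation β ((Measure.infinitePi fun _ : ι => μ).map E.series)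
      ((Measure.infinitePi fun _ : ι => ν).map E.series) := fun ϱ => by
  refine tendsto_nhds_unique (E.tendsto_prod_charFun hE hμ ϱ)
    (((E.tendsto_prod_charFun hE hμ (β • ϱ)).mul (E.tendsto_prod_charFun hE hν ϱ)).congr
      fun s => ?_)
  rw [← Finset.prod_mul_distrib]
  refine Finset.prod_congr rfl fun k _ => ?_
  rw [h (E.eigenvalue k * ϱ _), _root_.smul_apply, smul_eq_mul, mul_left_comm β]

end RandomSeries

end BesselKPrior

end

/-! ### Assembly of the main theorem -/

theorem mainTheorem2 {X : Type*} [NormedAddCommGroup X] [InnerProductSpace ℝ X] [CompleteSpace X]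
    [TopologicalSpace.SeparableSpace X] [MeasurableSpace X] [BorelSpace X]
    {ι : Type*} [Countable ι] (R : X →L[ℝ] X) (hR : BesselKPrior.IsHilbertSchmidt R)
    (E : BesselKPrior.EigenSystem ι R) (p : ℝ) (hp : 0 < p) :
    -- the series defining `BK(p, R)` converges almost surely
    (∀ᵐ η ∂(Measure.infinitePi fun _ : ι => BesselKPrior.besselK p 1),
      Summable fun k => (E.eigenvalue k * η k) • E.eigenvector k) ∧
    BesselKPrior.IsSelfDecomposable (BesselKPrior.besselKPrior p E) ∧
    ∀ β ∈ Set.Ioo (0 : ℝ) 1,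
      BesselKPrior.IsRadonProbability (BesselKPrior.besselKPriorInnovation β p E) ∧
      BesselKPrior.IsInnovation β (BesselKPrior.besselKPrior p E)
        (BesselKPrior.besselKPriorInnovation β p E) ∧
      (∀ ϱ : StrongDual ℝ X,
        charFunDual (BesselKPrior.besselKPrior p E) ϱ =
          charFunDual (BesselKPrior.besselKPrior p (E.smul β)) ϱ *
            charFunDual (BesselKPrior.besselKPriorInnovation β p E) ϱ) ∧
      -- for every i.i.d. sequence of `BK_β(p, 1)` variables, the series `v` converges almost
      -- surely and `v` has law `BK_β(p, R)`
      ∀ {Ω : Type*} [MeasurableSpace Ω] (P : Measure Ω) [IsProbabilityMeasure P]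
        (ηβ : ι → Ω → ℝ), iIndepFun ηβ P →
        (∀ k, HasLaw (ηβ k) (BesselKPrior.besselKInnovation β p 1) P) →
        (∀ᵐ ω ∂P, Summable fun k => (E.eigenvalue k * ηβ k ω) • E.eigenvector k) ∧
        HasLaw (fun ω => ∑' k, (E.eigenvalue k * ηβ k ω) • E.eigenvector k)
          (BesselKPrior.besselKPriorInnovation β p E) P := by
  have hE := E.summable_sq_eigenvalue hR
  have hB := BesselKPrior.isProbabilityMeasure_besselK hp
  have hB2 := BesselKPrior.lintegral_sq_besselK_lt_top hp
  have hI2 : ∀ β ∈ Set.Ioo (0 : ℝ) 1, _ := fun β hβ =>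
    BesselKPrior.lintegral_sq_besselKInnovation_lt_top hβ hp
  have hrad : ∀ β ∈ Set.Ioo (0 : ℝ) 1,
      BesselKPrior.IsRadonProbability (BesselKPrior.besselKPriorInnovation β p E) :=
    fun β hβ => E.isRadonProbability_map_series hE (hI2 β hβ)
  have hinn : ∀ β ∈ Set.Ioo (0 : ℝ) 1, BesselKPrior.IsInnovation β
      (BesselKPrior.besselKPrior p E) (BesselKPrior.besselKPriorInnovation β p E) :=
    fun β hβ => E.isInnovation_map_series hE hB2 (hI2 β hβ)
      (BesselKPrior.charFun_besselK_eq_mul hβ hp)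
  refine ⟨E.ae_summable hE hB2, ⟨E.isRadonProbability_map_series hE hB2,
    fun β hβ => ⟨_, hrad β hβ, hinn β hβ⟩⟩,
    fun β hβ => ⟨hrad β hβ, hinn β hβ, fun ϱ => ?_, ?_⟩⟩
  · rw [hinn β hβ ϱ, BesselKPrior.besselKPrior, BesselKPrior.besselKPrior,
      E.charFunDual_map_series_smul hE hB2]
  · intro Ω _ P _ ηβ hind hlaw
    -- Independence makes the law of the whole sequence the product measure, so both claims transfer
    -- from the canonical coefficients.
    have hη := hind.hasLaw_infinitePi hlaw (aemeasurable_pi_iff.2 fun k => (hlaw k).aemeasurable)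
    have hser : HasLaw E.series (BesselKPrior.besselKPriorInnovation β p E)
        (Measure.infinitePi fun _ : ι => BesselKPrior.besselKInnovation β p 1) :=
      ⟨E.aemeasurable_series hE (hI2 β hβ), rfl⟩
    refine ⟨ae_of_ae_map (p := fun η : ι → ℝ =>
      Summable fun k => (E.eigenvalue k * η k) • E.eigenvector k) hη.aemeasurable ?_, hser.comp hη⟩
    rw [hη.map_eq]
    exact E.ae_summable hE (hI2 β hβ)
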